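/- Definitions. Write $[n]=\{1,\dots,n\}$. For $T>0$, the perfect one-cold Poisson channel with duration $T$ takes as input a measurable function $x:[0,T]\to\mathbb{N}=\{1,2,\dots\}$ and outputs independent Poisson counting processes $(Y_i(t))_{t\in[0,T]}$, $i\in\mathbb{N}$, where $Y_i$ has intensity function $t\mapsto 1-\mathbf{1}\{x(t)=i\}$. A coding scheme for $M\ge 1$ messages consists of a channel input $x_k$ for every message $k\in[M]$ and a measurable decoding function from the output to $[M]$; its average error probability is the probability that the decoded message differs from the message, when the message is uniformly distributed on $[M]$. Let $M^*(\infty,0,T,\epsilon)\in\mathbb{N}\cup\{\infty\}$ be the largest $M\in\mathbb{N}$ for which there is a coding scheme for $M$ messages with average error probability at most $\epsilon$ ($\infty$ if there is no largest one), and let $\epsilon^*(\infty,0,T,M)=\inf\{\epsilon\ge 0: M^*(\infty,0,T,\epsilon)\ge M\}$. Statement. (1) For all $T>0$ and $0<\epsilon\le 1/12$, the maximum $M^*(\infty,0,T,\epsilon)$ exists (is finite and attained) and \[ \ln M^*(\infty,0,T,\epsilon)-\max\{T-\ln(1/\epsilon),\,0\}\in[0,2]. \] (2) For every rate $0<R<1$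 we have $\epsilon^*(\infty,0,T,\lceil e^{TR}\rceil)>0$ for all $T>0$, and the error exponent is \[ \liminf_{T\to\infty}\frac1T\ln\frac{1}{\epsilon^*(\infty,0,T,\lceil e^{TR}\rceil)}=1-R. \] -/

import Mathlib

open MeasureTheory ProbabilityTheory Filter Topology
open scoped NNReal ENNReal Nat

namespace OCPC

noncomputable section

/-- The set of bands `[L] = {1, …, L}`; for `L = ⊤` these are all positive integers. -/
abbrev Band (L : ℕ∞) : Type := {i : ℕ // 1 ≤ i ∧ (i : ℕ∞) ≤ L}

/-- The time interval `[0, T]`, with its Borel sets. -/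
abbrev Time (T : ℝ) : Type := Set.Icc (0 : ℝ) T

/-- Lebesgue measure on `[0, T]`. -/
def timeVolume (T : ℝ) : Measure (Time T) := (volume : Measure ℝ).comap Subtype.val

/-- The space of paths `t ↦ Y(t)`, with the σ-algebra generated by the evaluations. -/
abbrev Path (T : ℝ) : Type := Time T → ℕ

/-- The counting path of the points `s 0, …, s (n - 1)` (with multiplicity):
its value at `t` is the number of points in `[0, t]`. -/
def countingPath {T : ℝ} {n : ℕ} (s : Fin n → Time T) : Path T :=
  fun t => (Finset.univ.filter fun j => s j ≤ t).card

lemma measurable_countingPath (T : ℝ) (n : ℕ) :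
    Measurable (countingPath : (Fin n → Time T) → Path T) := by
  refine measurable_pi_lambda _ fun t => ?_
  have h : (fun s : Fin n → Time T => countingPath s t)
      = fun s => ∑ j : Fin n, if s j ≤ t then 1 else 0 := by
    funext s
    exact Finset.card_filter _ _
  rw [h]
  refine Finset.measurable_sum _ fun j _ => ?_
  exact Measurable.ite (measurableSet_le (measurable_pi_apply j) measurable_const)
    measurable_const measurable_const

/-- The law of the Poisson counting process on `[0, T]` with finite intensity measure `ν`:
the number `n` of points is Poisson with mean `ν([0, T])` and, given `n`, the points are i.i.d.
with law `ν / ν([0, T])`.  The two normalisations cancel, so that the part of the law carried by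
`n` points is `exp (-ν([0, T])) / n!` times the image of the product measure `ν ⊗ ⋯ ⊗ ν`. -/
def poissonProcessLaw {T : ℝ} (ν : Measure (Time T)) : Measure (Path T) :=
  Measure.sum fun n : ℕ =>
    ENNReal.ofReal (Real.exp (-ν.real Set.univ) / (n ! : ℝ)) •
      (Measure.pi fun _ : Fin n => ν).map countingPath

instance isProbabilityMeasure_poissonProcessLaw {T : ℝ} (ν : Measure (Time T))
    [IsFiniteMeasure ν] : IsProbabilityMeasure (poissonProcessLaw ν) := by
  constructor
  have hr : 0 ≤ ν.real Set.univ := measureReal_nonneg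
  have hterm : ∀ n : ℕ, (ENNReal.ofReal (Real.exp (-ν.real Set.univ) / (n ! : ℝ)) •
      (Measure.pi fun _ : Fin n => ν).map (countingPath (T := T))) Set.univ
      = ENNReal.ofReal
        (Real.exp (-ν.real Set.univ) * (ν.real Set.univ) ^ n / (n ! : ℝ)) := by
    intro n
    rw [Measure.smul_apply, Measure.map_apply (measurable_countingPath T n) MeasurableSet.univ,
      Set.preimage_univ, Measure.pi_univ, Finset.prod_const, Finset.card_univ, Fintype.card_fin,
      smul_eq_mul, ← ofReal_measureReal (μ := ν) (s := Set.univ), ← ENNReal.ofReal_pow hr,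
      ← ENNReal.ofReal_mul (by positivity)]
    congr 1
    ring
  have hs : HasSum (fun n : ℕ =>
      Real.exp (-ν.real Set.univ) * (ν.real Set.univ) ^ n / (n ! : ℝ)) 1 :=
    hasSum_one_poissonMeasure ⟨ν.real Set.univ, hr⟩
  rw [poissonProcessLaw, Measure.sum_apply _ MeasurableSet.univ, tsum_congr hterm,
    ← ENNReal.ofReal_tsum_of_nonneg (fun n => by positivity) hs.summable, hs.tsum_eq,
    ENNReal.ofReal_one]

/-- The intensity measure of band `i` under the input `x`: its Lebesgue density at time `t` is
`1 - (1 - α) 1{x(t) = i}`, that is, `α` if `x(t) = i` and `1` otherwise. -/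
def intensity {L : ℕ∞} (α : ℝ≥0) {T : ℝ} (x : Time T → Band L) (i : Band L) :
    Measure (Time T) :=
  (timeVolume T).withDensity fun t => if x t = i then (α : ℝ≥0∞) else 1

instance isFiniteMeasure_intensity {L : ℕ∞} (α : ℝ≥0) {T : ℝ} (x : Time T → Band L)
    (i : Band L) : IsFiniteMeasure (intensity α x i) := by
  refine isFiniteMeasure_withDensity (ne_of_lt ?_)
  have hv : timeVolume T Set.univ < ∞ := by
    rw [timeVolume, (MeasurableEmbedding.subtype_coe measurableSet_Icc).comap_apply,
      Set.image_univ, Subtype.range_coe]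
    exact measure_Icc_lt_top
  calc ∫⁻ t, (if x t = i then (α : ℝ≥0∞) else 1) ∂timeVolume T
      ≤ ∫⁻ _, max (α : ℝ≥0∞) 1 ∂timeVolume T := lintegral_mono fun t => by
        dsimp only
        split_ifs
        · exact le_max_left _ _
        · exact le_max_right _ _
    _ = max (α : ℝ≥0∞) 1 * timeVolume T Set.univ := lintegral_const _
    _ < ∞ := ENNReal.mul_lt_top (max_lt ENNReal.coe_lt_top ENNReal.one_lt_top) hv

/-- The `(L, α)`-one-cold Poisson channel with duration `T`: the law of the output
`(Y_i)_{i ∈ [L]}` given the input `x`.  The `Y_i` are independent Poisson counting processes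
on `[0, T]`, and `Y_i` has intensity function `t ↦ 1 - (1 - α) 1{x(t) = i}`. -/
def channel (L : ℕ∞) (α : ℝ≥0) (T : ℝ) (x : Time T → Band L) : Measure (Band L → Path T) :=
  Measure.infinitePi fun i => poissonProcessLaw (intensity α x i)

/-- A coding scheme with `M` messages: a measurable channel input for every message, and a
measurable decoding function. -/
structure Code (L : ℕ∞) (T : ℝ) (M : ℕ) where
  /-- the channel input of a message -/
  enc : Fin M → Time T → Band L
  measurable_enc : ∀ k, Measurable (enc k)
  /-- the decoded message -/
  dec : (Band L → Path T) → Fin M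
  measurable_dec : Measurable dec

/-- The average error probability for a uniformly distributed message. -/
def Code.avgError {L : ℕ∞} {T : ℝ} {M : ℕ} (c : Code L T M) (α : ℝ≥0) : ℝ :=
  (∑ k : Fin M, (channel L α T (c.enc k)).real {y | c.dec y ≠ k}) / (M : ℝ)

/-- The set of the positive integers `M` for which `M` messages can be sent with average error
probability at most `ε`. -/
def achievable (L : ℕ∞) (α : ℝ≥0) (T ε : ℝ) : Set ℕ :=
  {M | 1 ≤ M ∧ ∃ c : Code L T M, c.avgError α ≤ ε}

/-- `M*(L, α, T, ε)`: the largest achievable number of messages (`⊤` if there is no largest). -/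
def maxMessages (L : ℕ∞) (α : ℝ≥0) (T ε : ℝ) : ℕ∞ :=
  ⨆ M ∈ achievable L α T ε, (M : ℕ∞)

/-- `ε*(L, α, T, M) = inf {ε ≥ 0 : M*(L, α, T, ε) ≥ M}`: the optimal error probability. -/
def optError (L : ℕ∞) (α : ℝ≥0) (T : ℝ) (M : ℕ) : ℝ :=
  sInf {ε : ℝ | 0 ≤ ε ∧ (M : ℕ∞) ≤ maxMessages L α T ε}

end

end OCPC

/-!
Take independent Poisson processes of rate `1` in all bands. The graph of an input `x` has Lebesgue
measure `T`, so it contains no point with probability `p = exp (-T)`, and conditioned on this void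
event `V x` the processes have exactly the law of the channel output for `x`. The probabilities of
correct decoding therefore sum to at most `P (⋃ k, V (x k)) / p`. Void events are positively
correlated with unions of void events, which gives
`P (⋃ k, V (x k)) ≤ 1 - (1 - p) ^ M = p * ∑ j < M, (1 - p) ^ j`. Constant inputs in distinct bands,
decoded by the first band without points, attain this bound, so that the optimal average error
probability is exactly `(∑ j < M, (1 - (1 - p) ^ j)) / M`. This is at most `(M - 1) * p / 2`, and it
is of this order as long as `(M - 1) * p` stays bounded.
-/

namespace OCPC

noncomputable section

section ProductMeasure

variable {ι : Type*} [Countable ι] {X : ι → Type*} [∀ i, MeasurableSpace (X i)]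
  (μ : (i : ι) → Measure (X i)) [∀ i, IsProbabilityMeasure (μ i)]

theorem hasProd_infinitePi_real_univ_pi {A : (i : ι) → Set (X i)}
    (hA : ∀ i, MeasurableSet (A i)) :
    HasProd (fun i => (μ i).real (A i)) ((Measure.infinitePi μ).real (Set.univ.pi A)) := by
  have h : HasProd (fun i => μ i (A i)) (Measure.infinitePi μ (Set.univ.pi A)) := by
    rw [Measure.infinitePi_pi_univ μ hA]
    exact (ENNReal.multipliable_of_le_one fun i => prob_le_one).hasProd
  exact ((ENNReal.tendsto_toReal (measure_ne_top _ _)).comp h).congr fun s =>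
    ENNReal.toReal_prod _ _

theorem infinitePi_real_univ_pi_inter_pi {A : (i : ι) → Set (X i)}
    (hA : ∀ i, MeasurableSet (A i)) (s : Finset ι) {t : (i : ι) → Set (X i)}
    (ht : ∀ i, MeasurableSet (t i)) :
    (Measure.infinitePi μ).real (Set.univ.pi A ∩ Set.pi s t)
      = (Measure.infinitePi μ).real (Set.univ.pi A) * ∏ i ∈ s, (cond (μ i) (A i)).real (t i) := by
  classical
  let t' : (i : ι) → Set (X i) := fun i => if i ∈ s then t i else Set.univ
  have hinter : Set.univ.pi A ∩ Set.pi s t = Set.univ.pi fun i => A i ∩ t' i := by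
    rw [Set.pi_inter_distrib]
    exact congrArg (Set.univ.pi A ∩ ·) (Set.univ_pi_ite (s : Set ι) t).symm
  have ht'm : ∀ i, MeasurableSet (A i ∩ t' i) := fun i =>
    (hA i).inter (by simp only [t']; split_ifs; exacts [ht i, .univ])
  rw [hinter]
  refine (hasProd_infinitePi_real_univ_pi μ ht'm).unique ?_
  have hprod : HasProd (fun i => if i ∈ s then (cond (μ i) (A i)).real (t i) else 1)
      (∏ i ∈ s, (cond (μ i) (A i)).real (t i)) := by
    rw [← Finset.prod_congr rfl fun i hi => if_pos hi]
    exact hasProd_prod_of_ne_finset_one fun i hi => if_neg hi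
  refine ((hasProd_infinitePi_real_univ_pi μ hA).mul hprod).congr_fun fun i => ?_
  by_cases hi : i ∈ s
  · simp only [t', hi, if_true, Measure.real, ← ENNReal.toReal_mul]
    rw [mul_comm, cond_mul_eq_inter (hA i)]
  · simp [t', hi]

theorem cond_infinitePi_univ_pi {A : (i : ι) → Set (X i)} (hA : ∀ i, MeasurableSet (A i))
    (hne : Measure.infinitePi μ (Set.univ.pi A) ≠ 0) :
    cond (Measure.infinitePi μ) (Set.univ.pi A)
      = Measure.infinitePi fun i => cond (μ i) (A i) := by
  have hAne : ∀ i, μ i (A i) ≠ 0 := fun i h0 => by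
    have hpre : Measure.infinitePi μ (Function.eval i ⁻¹' A i) = 0 := by
      rw [(measurePreserving_eval_infinitePi μ i).measure_preimage (hA i).nullMeasurableSet, h0]
    exact hne (measure_mono_null (fun y hy => hy i (Set.mem_univ i)) hpre)
  have : ∀ i, IsProbabilityMeasure (cond (μ i) (A i)) := fun i =>
    cond_isProbabilityMeasure (hAne i)
  refine Measure.eq_infinitePi _ fun s t ht => ?_
  have hAm : MeasurableSet (Set.univ.pi A) := .univ_pi hA
  have hfactor : Measure.infinitePi μ (Set.univ.pi A ∩ Set.pi s t)
      = Measure.infinitePi μ (Set.univ.pi A) * ∏ i ∈ s, cond (μ i) (A i) (t i) := by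
    rw [← ENNReal.toReal_eq_toReal_iff' (measure_ne_top _ _) (ENNReal.mul_ne_top
      (measure_ne_top _ _) (ENNReal.prod_ne_top fun i _ => measure_ne_top _ _)),
      ENNReal.toReal_mul, ENNReal.toReal_prod]
    exact infinitePi_real_univ_pi_inter_pi μ hA s ht
  rw [cond_apply hAm, hfactor, ENNReal.inv_mul_cancel_left hne (measure_ne_top _ _)]

end ProductMeasure

section IndepAvoidance

variable {Ω B : Type*} [MeasurableSpace Ω] [GeneralizedBooleanAlgebra B]

/-- The avoidance events of a completely random set: `V a` is the event that the random set misses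
the region `a`, and the parts of the set in disjoint regions are independent. -/
structure IsIndepAvoidance (P : Measure Ω) (V : B → Set Ω) : Prop where
  measurableSet : ∀ a, MeasurableSet (V a)
  sup : ∀ a b, V (a ⊔ b) = V a ∩ V b
  indep : ∀ a b, Disjoint a b → P.real (V a ∩ V b) = P.real (V a) * P.real (V b)

namespace IsIndepAvoidance

variable {P : Measure Ω} {V : B → Set Ω}

theorem antitone (h : IsIndepAvoidance P V) : Antitone V := fun a b hab => by
  rw [← sup_eq_right.2 hab, h.sup]
  exact Set.inter_subset_left

variable [IsProbabilityMeasure P]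

theorem real_inter_iInter_compl (h : IsIndepAvoidance P V) {κ : Type*} (s : Finset κ) {a : B}
    {b : κ → B} (hab : ∀ k, Disjoint a (b k)) :
    P.real (V a ∩ ⋂ k ∈ s, (V (b k))ᶜ) = P.real (V a) * P.real (⋂ k ∈ s, (V (b k))ᶜ) := by
  let 𝒜 : Set (Set Ω) := V '' {c | Disjoint a c}
  have hpi : IsPiSystem 𝒜 := by
    rintro _ ⟨c, hc, rfl⟩ _ ⟨d, hd, rfl⟩ -
    exact ⟨c ⊔ d, hc.sup_right hd, h.sup c d⟩
  have hindep : Indep (MeasurableSpace.generateFrom {V a}) (MeasurableSpace.generateFrom 𝒜) P := by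
    refine IndepSets.indep' ?_ ?_ (IsPiSystem.singleton _) hpi ?_
    · rintro _ rfl
      exact h.measurableSet a
    · rintro _ ⟨c, -, rfl⟩
      exact h.measurableSet c
    · rw [IndepSets_iff]
      rintro _ _ rfl ⟨c, hc, rfl⟩
      rw [← ENNReal.toReal_eq_toReal_iff' (by finiteness) (by finiteness), ENNReal.toReal_mul]
      exact h.indep a c hc
  have hmul := (Indep_iff _ _ _).1 hindep (V a) (⋂ k ∈ s, (V (b k))ᶜ)
    (MeasurableSpace.measurableSet_generateFrom rfl)
    (Finset.measurableSet_biInter s fun k _ =>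
      (MeasurableSpace.measurableSet_generateFrom (Set.mem_image_of_mem V (hab k))).compl)
  simp only [Measure.real, hmul, ENNReal.toReal_mul]

theorem real_inter_iInter_compl_le (h : IsIndepAvoidance P V) {κ : Type*} (s : Finset κ) (a : B)
    (b : κ → B) :
    P.real (V a ∩ ⋂ k ∈ s, (V (b k))ᶜ) ≤ P.real (V a) * P.real (⋂ k ∈ s, (V (b k))ᶜ) := by
  -- Once `a` is missed, missing `b k` only depends on the part of `b k` outside `a`.
  have hsdiff : V a ∩ ⋂ k ∈ s, (V (b k))ᶜ = V a ∩ ⋂ k ∈ s, (V (b k \ a))ᶜ := by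
    ext ω
    refine and_congr_right fun hω => ?_
    have hiff : ∀ k, ω ∈ V (b k) ↔ ω ∈ V (b k \ a) := fun k => by
      have : V a ∩ V (b k) = V a ∩ V (b k \ a) := by rw [← h.sup, ← h.sup, sup_sdiff_self_right]
      simpa [hω] using Set.ext_iff.1 this ω
    simp only [Set.mem_iInter, Set.mem_compl_iff, hiff]
  calc P.real (V a ∩ ⋂ k ∈ s, (V (b k))ᶜ)
      = P.real (V a) * P.real (⋂ k ∈ s, (V (b k \ a))ᶜ) := by
        rw [hsdiff, h.real_inter_iInter_compl s fun k => disjoint_sdiff_self_right]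
    _ ≤ P.real (V a) * P.real (⋂ k ∈ s, (V (b k))ᶜ) := by
        refine mul_le_mul_of_nonneg_left (measureReal_mono ?_) measureReal_nonneg
        exact Set.iInter₂_mono fun k _ => Set.compl_subset_compl.2 (h.antitone sdiff_le)

theorem prod_one_sub_le_real_iInter_compl (h : IsIndepAvoidance P V) {κ : Type*} (s : Finset κ)
    (b : κ → B) :
    ∏ k ∈ s, (1 - P.real (V (b k))) ≤ P.real (⋂ k ∈ s, (V (b k))ᶜ) := by
  classical
  induction s using Finset.induction_on with
  | empty => simp
  | insert a s ha ih =>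
    have hsplit := measureReal_inter_add_sdiff (μ := P) (s := ⋂ k ∈ s, (V (b k))ᶜ)
      (h.measurableSet (b a))
    have hle := h.real_inter_iInter_compl_le s (b a) b
    rw [Finset.prod_insert ha, Finset.set_biInter_insert, Set.inter_comm, ← Set.sdiff_eq]
    rw [Set.inter_comm] at hsplit
    have hprob : P.real (V (b a)) ≤ 1 := measureReal_le_one
    linarith [mul_le_mul_of_nonneg_left ih (sub_nonneg.2 hprob)]

theorem sum_cond_real_le (h : IsIndepAvoidance P V) {κ : Type*} [Fintype κ] {b : κ → B} {p : ℝ}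
    (hp : 0 < p) (hb : ∀ k, P.real (V (b k)) = p) {D : κ → Set Ω}
    (hD : ∀ k, MeasurableSet (D k)) (hdisj : Pairwise (Function.onFun Disjoint D)) :
    ∑ k, (cond P (V (b k))).real (D k) ≤ ∑ j ∈ Finset.range (Fintype.card κ), (1 - p) ^ j := by
  have hcond : ∀ k, (cond P (V (b k))).real (D k) = p⁻¹ * P.real (V (b k) ∩ D k) := fun k => by
    rw [Measure.real, cond_apply (h.measurableSet _), ENNReal.toReal_mul, ENNReal.toReal_inv,
      ← Measure.real, ← Measure.real, hb]
  have hgeom : p * ∑ j ∈ Finset.range (Fintype.card κ), (1 - p) ^ j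
      = 1 - (1 - p) ^ Fintype.card κ := by
    simpa using mul_neg_geom_sum (1 - p) (Fintype.card κ)
  have hunion : (⋃ k, V (b k)) = (⋂ k ∈ Finset.univ, (V (b k))ᶜ)ᶜ := by simp [Set.compl_iInter]
  have hmiss : (1 - p) ^ Fintype.card κ ≤ P.real (⋂ k ∈ Finset.univ, (V (b k))ᶜ) := by
    simpa [hb] using h.prod_one_sub_le_real_iInter_compl Finset.univ b
  simp only [hcond]
  rw [← Finset.mul_sum, inv_mul_le_iff₀ hp, hgeom]
  calc ∑ k, P.real (V (b k) ∩ D k)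
      = P.real (⋃ k, V (b k) ∩ D k) := by
        rw [measureReal_iUnion_fintype _ fun k => (h.measurableSet _).inter (hD k)]
        exact fun k l hkl => (hdisj hkl).mono Set.inter_subset_right Set.inter_subset_right
    _ ≤ P.real (⋃ k, V (b k)) := measureReal_mono (Set.iUnion_mono fun k => Set.inter_subset_left)
    _ = 1 - P.real (⋂ k ∈ Finset.univ, (V (b k))ᶜ) := by
        rw [hunion, probReal_compl_eq_one_sub
          (Finset.measurableSet_biInter _ fun k _ => (h.measurableSet _).compl)]
    _ ≤ 1 - (1 - p) ^ Fintype.card κ := sub_le_sub_left hmiss 1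

end IsIndepAvoidance

end IndepAvoidance

section PoissonPoints

/-- Finite configurations of labelled points of `E`. The channel outputs only show the paths of a
point process, on which having no point in a general measurable set is not an event of the
evaluation σ-algebra; on configurations it is. -/
abbrev Configuration (E : Type*) : Type _ := Σ n : ℕ, Fin n → E

variable {E : Type*}

/-- The configurations that have no point in `B`. -/
def voidEvent (B : Set E) : Set (Configuration E) := {c | ∀ j, c.2 j ∉ B}

theorem voidEvent_union (A B : Set E) : voidEvent (A ∪ B) = voidEvent A ∩ voidEvent B := by
  ext c
  simp only [voidEvent, Set.mem_ofPred_eq, Set.mem_union, not_or, forall_and, Set.mem_inter_iff]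

theorem sigmaMk_preimage_voidEvent (B : Set E) (n : ℕ) :
    Sigma.mk n ⁻¹' voidEvent B = Set.univ.pi fun _ : Fin n => Bᶜ := by
  ext s
  simp [voidEvent, Set.mem_pi]

variable [MeasurableSpace E]

theorem measurable_sigmaMk (n : ℕ) :
    Measurable (fun s => ⟨n, s⟩ : (Fin n → E) → Configuration E) :=
  fun _ hs => MeasurableSpace.measurableSet_iInf.1 hs n

theorem measurable_of_comp_sigmaMk {F : Type*} [MeasurableSpace F] {f : Configuration E → F}
    (hf : ∀ n, Measurable fun s : Fin n → E => f ⟨n, s⟩) : Measurable f :=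
  fun _ hs => MeasurableSpace.measurableSet_iInf.2 fun n => hf n hs

theorem measurableSet_voidEvent {B : Set E} (hB : MeasurableSet B) :
    MeasurableSet (voidEvent B) := by
  refine MeasurableSpace.measurableSet_iInf.2 fun n => ?_
  change MeasurableSet (Sigma.mk n ⁻¹' voidEvent B)
  rw [sigmaMk_preimage_voidEvent]
  exact .univ_pi fun _ => hB.compl

/-- The law of the Poisson point process with finite intensity measure `ν`, with its points
labelled in uniformly random order; it is decomposed by the number of points in the same way as
`poissonProcessLaw`. -/
def poissonPointLaw (ν : Measure E) : Measure (Configuration E) :=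
  Measure.sum fun n : ℕ =>
    ENNReal.ofReal (Real.exp (-ν.real Set.univ) / (n ! : ℝ)) •
      (Measure.pi fun _ : Fin n => ν).map (Sigma.mk n)

variable (ν : Measure E) [IsFiniteMeasure ν] {B : Set E}

instance isProbabilityMeasure_poissonPointLaw : IsProbabilityMeasure (poissonPointLaw ν) := by
  have hr : 0 ≤ ν.real Set.univ := measureReal_nonneg
  have hterm (n : ℕ) : (ENNReal.ofReal (Real.exp (-ν.real Set.univ) / (n ! : ℝ)) •
      (Measure.pi fun _ : Fin n => ν).map (fun s => ⟨n, s⟩ : _ → Configuration E)) Set.univ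
        = ENNReal.ofReal (Real.exp (-ν.real Set.univ) * ν.real Set.univ ^ n / (n ! : ℝ)) := by
    rw [Measure.smul_apply, Measure.map_apply (measurable_sigmaMk n) .univ, Set.preimage_univ,
      Measure.pi_univ, Finset.prod_const, Finset.card_univ, Fintype.card_fin, smul_eq_mul,
      ← ofReal_measureReal, ← ENNReal.ofReal_pow hr, ← ENNReal.ofReal_mul (by positivity),
      div_mul_eq_mul_div]
  have hsum : HasSum (fun n : ℕ =>
      Real.exp (-ν.real Set.univ) * ν.real Set.univ ^ n / (n ! : ℝ)) 1 :=
    hasSum_one_poissonMeasure ⟨ν.real Set.univ, hr⟩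
  constructor
  rw [poissonPointLaw, Measure.sum_apply _ .univ, tsum_congr hterm,
    ← ENNReal.ofReal_tsum_of_nonneg (fun n => by positivity) hsum.summable, hsum.tsum_eq,
    ENNReal.ofReal_one]

theorem poissonPointLaw_restrict_voidEvent (hB : MeasurableSet B) :
    (poissonPointLaw ν).restrict (voidEvent B)
      = ENNReal.ofReal (Real.exp (-ν.real B)) • poissonPointLaw (ν.restrict Bᶜ) := by
  have hexp : Real.exp (-ν.real Set.univ) = Real.exp (-ν.real B) * Real.exp (-ν.real Bᶜ) := by
    rw [← Real.exp_add, ← measureReal_add_measureReal_compl hB, neg_add]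
  rw [poissonPointLaw, poissonPointLaw, Measure.restrict_sum _ (measurableSet_voidEvent hB)]
  ext s hs
  rw [Measure.smul_apply, Measure.sum_apply _ hs, Measure.sum_apply _ hs, smul_eq_mul,
    ← ENNReal.tsum_mul_left]
  refine tsum_congr fun n => ?_
  rw [← smul_eq_mul, ← Measure.smul_apply, Measure.restrict_smul,
    Measure.restrict_map (measurable_sigmaMk n) (measurableSet_voidEvent hB),
    sigmaMk_preimage_voidEvent, Measure.restrict_pi_pi, smul_smul,
    ← ENNReal.ofReal_mul (Real.exp_pos _).le, measureReal_restrict_apply_univ, hexp, mul_div_assoc]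

theorem poissonPointLaw_voidEvent (hB : MeasurableSet B) :
    poissonPointLaw ν (voidEvent B) = ENNReal.ofReal (Real.exp (-ν.real B)) := by
  simpa using congrArg (fun μ => μ Set.univ) (poissonPointLaw_restrict_voidEvent ν hB)

theorem poissonPointLaw_real_voidEvent (hB : MeasurableSet B) :
    (poissonPointLaw ν).real (voidEvent B) = Real.exp (-ν.real B) := by
  rw [Measure.real, poissonPointLaw_voidEvent ν hB, ENNReal.toReal_ofReal (Real.exp_pos _).le]

theorem cond_poissonPointLaw_voidEvent (hB : MeasurableSet B) :
    cond (poissonPointLaw ν) (voidEvent B) = poissonPointLaw (ν.restrict Bᶜ) := by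
  rw [ProbabilityTheory.cond, poissonPointLaw_restrict_voidEvent ν hB,
    poissonPointLaw_voidEvent ν hB, smul_smul,
    ENNReal.inv_mul_cancel (by simpa using Real.exp_pos _) ENNReal.ofReal_ne_top, one_smul]

end PoissonPoints

section PoissonField

variable {ι E : Type*} [MeasurableSpace E]

/-- A region of the disjoint union of `ι` copies of `E`, given by its part in every copy. -/
abbrev Region (ι E : Type*) [MeasurableSpace E] : Type _ := ι → {B : Set E // MeasurableSet B}

/-- The event that the region `G` contains no point of a family of configurations. -/
def regionVoid (G : Region ι E) : Set (ι → Configuration E) :=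
  Set.univ.pi fun i => voidEvent (G i : Set E)

theorem regionVoid_sup (G H : Region ι E) :
    regionVoid (G ⊔ H) = regionVoid G ∩ regionVoid H := by
  rw [regionVoid, regionVoid, regionVoid, ← Set.pi_inter_distrib]
  exact congrArg _ (funext fun i => voidEvent_union _ _)

/-- The joint law of independent Poisson point processes with intensity measures `ν i`. -/
def poissonFieldLaw (ν : ι → Measure E) : Measure (ι → Configuration E) :=
  Measure.infinitePi fun i => poissonPointLaw (ν i)

variable (ν : ι → Measure E) [∀ i, IsFiniteMeasure (ν i)]

instance isProbabilityMeasure_poissonFieldLaw : IsProbabilityMeasure (poissonFieldLaw ν) :=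
  inferInstanceAs (IsProbabilityMeasure (Measure.infinitePi _))

variable [Countable ι]

theorem hasProd_poissonFieldLaw_real_regionVoid (G : Region ι E) :
    HasProd (fun i => Real.exp (-(ν i).real (G i))) ((poissonFieldLaw ν).real (regionVoid G)) := by
  simpa only [poissonPointLaw_real_voidEvent _ (G _).2, poissonFieldLaw, regionVoid] using
    hasProd_infinitePi_real_univ_pi (fun i => poissonPointLaw (ν i))
      fun i => measurableSet_voidEvent (G i).2

theorem poissonFieldLaw_real_regionVoid {G : Region ι E} {a : ℝ}
    (ha : HasSum (fun i => (ν i).real (G i)) a) :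
    (poissonFieldLaw ν).real (regionVoid G) = Real.exp (-a) :=
  (hasProd_poissonFieldLaw_real_regionVoid ν G).unique ha.neg.rexp

theorem isIndepAvoidance_regionVoid :
    IsIndepAvoidance (poissonFieldLaw ν) (regionVoid : Region ι E → Set (ι → Configuration E)) where
  measurableSet G := .univ_pi fun i => measurableSet_voidEvent (G i).2
  sup G H := regionVoid_sup G H
  indep G H hGH := by
    have hdisj (i : ι) : Disjoint (G i : Set E) (H i) := by
      rw [Set.disjoint_iff_inter_eq_empty]
      exact congrArg Subtype.val (disjoint_iff.1 (Pi.disjoint_iff.1 hGH i))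
    have hunion (i : ι) : Real.exp (-(ν i).real ((G ⊔ H) i : Set E))
        = Real.exp (-(ν i).real (G i)) * Real.exp (-(ν i).real (H i)) := by
      rw [← Real.exp_add, ← neg_add, ← measureReal_union (hdisj i) (H i).2]
      rfl
    rw [← regionVoid_sup]
    refine (hasProd_poissonFieldLaw_real_regionVoid ν (G ⊔ H)).unique ?_
    simpa only [hunion] using (hasProd_poissonFieldLaw_real_regionVoid ν G).mul
      (hasProd_poissonFieldLaw_real_regionVoid ν H)

theorem cond_poissonFieldLaw_regionVoid {G : Region ι E}
    (hG : poissonFieldLaw ν (regionVoid G) ≠ 0) :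
    cond (poissonFieldLaw ν) (regionVoid G)
      = poissonFieldLaw fun i => (ν i).restrict (G i : Set E)ᶜ := by
  rw [poissonFieldLaw, regionVoid, cond_infinitePi_univ_pi _
    (fun i => measurableSet_voidEvent (G i).2) hG]
  simp only [cond_poissonPointLaw_voidEvent _ (G _).2, poissonFieldLaw]

end PoissonField

section Channel

variable {T : ℝ} {L : ℕ∞}

/-- The counting path of a configuration of points of `[0, T]`. -/
def configurationPath (c : Configuration (Time T)) : Path T := countingPath c.2

theorem measurable_configurationPath :
    Measurable (configurationPath : Configuration (Time T) → Path T) :=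
  measurable_of_comp_sigmaMk fun n => measurable_countingPath T n

theorem map_configurationPath_poissonPointLaw (ν : Measure (Time T)) :
    (poissonPointLaw ν).map configurationPath = poissonProcessLaw ν := by
  rw [poissonPointLaw, poissonProcessLaw,
    Measure.map_sum measurable_configurationPath.aemeasurable]
  congr 1 with n : 1
  rw [Measure.map_smul, Measure.map_map measurable_configurationPath (measurable_sigmaMk n)]
  rfl

theorem timeVolume_univ : timeVolume T Set.univ = ENNReal.ofReal T := by
  rw [timeVolume, (MeasurableEmbedding.subtype_coe measurableSet_Icc).comap_apply, Set.image_univ,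
    Subtype.range_coe, Real.volume_Icc, sub_zero]

theorem timeVolume_real_univ (hT : 0 ≤ T) : (timeVolume T).real Set.univ = T := by
  rw [Measure.real, timeVolume_univ, ENNReal.toReal_ofReal hT]

instance isFiniteMeasure_timeVolume : IsFiniteMeasure (timeVolume T) :=
  ⟨timeVolume_univ (T := T) ▸ ENNReal.ofReal_lt_top⟩

theorem intensity_zero {x : Time T → Band L} (hx : Measurable x) (i : Band L) :
    intensity 0 x i = (timeVolume T).restrict (x ⁻¹' {i})ᶜ := by
  rw [intensity, ← withDensity_indicator_one (hx (measurableSet_singleton i)).compl]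
  congr 1 with t
  by_cases h : x t = i <;> simp [h]

/-- The graph `{(x t, t)}` of a channel input, as a region of the time-band plane: the points of
rate-`1` Poisson processes that the channel suppresses. -/
def inputRegion (x : Time T → Band L) (hx : Measurable x) : Region (Band L) (Time T) :=
  fun i => ⟨x ⁻¹' {i}, hx (measurableSet_singleton i)⟩

theorem hasSum_timeVolume_inputRegion (hT : 0 ≤ T) {x : Time T → Band L} (hx : Measurable x) :
    HasSum (fun i => (timeVolume T).real (inputRegion x hx i)) T := by
  have hunion : (⋃ i, x ⁻¹' {i}) = Set.univ := by
    rw [← Set.preimage_iUnion, Set.iUnion_of_singleton, Set.preimage_univ]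
  have htsum : ∑' i, timeVolume T (x ⁻¹' {i}) = timeVolume T Set.univ := by
    rw [← hunion, measure_iUnion (fun i j hij => (Set.disjoint_singleton.2 hij).preimage x)
      fun i => hx (measurableSet_singleton i)]
  have hsum := ENNReal.hasSum_toReal (htsum ▸ measure_ne_top (timeVolume T) Set.univ)
  rwa [← ENNReal.tsum_toReal_eq fun i => measure_ne_top _ _, htsum, ← Measure.real,
    timeVolume_real_univ hT] at hsum

theorem poissonFieldLaw_real_inputRegion (hT : 0 ≤ T) {x : Time T → Band L} (hx : Measurable x) :
    (poissonFieldLaw fun _ : Band L => timeVolume T).real (regionVoid (inputRegion x hx))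
      = Real.exp (-T) :=
  poissonFieldLaw_real_regionVoid _ (hasSum_timeVolume_inputRegion hT hx)

theorem measurable_configurationPath_comp :
    Measurable fun (ω : Band L → Configuration (Time T)) i => configurationPath (ω i) :=
  measurable_pi_lambda _ fun i => measurable_configurationPath.comp (measurable_pi_apply i)

theorem channel_eq_map_cond (hT : 0 ≤ T) {x : Time T → Band L} (hx : Measurable x) :
    channel L 0 T x
      = (cond (poissonFieldLaw fun _ => timeVolume T) (regionVoid (inputRegion x hx))).map
          fun ω i => configurationPath (ω i) := by
  have hne : (poissonFieldLaw fun _ : Band L => timeVolume T) (regionVoid (inputRegion x hx)) ≠ 0 :=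
    fun h0 => (Real.exp_pos (-T)).ne' <| by
      rw [← poissonFieldLaw_real_inputRegion hT hx, Measure.real, h0, ENNReal.toReal_zero]
  rw [cond_poissonFieldLaw_regionVoid _ hne, poissonFieldLaw,
    Measure.infinitePi_map_pi _ fun _ => measurable_configurationPath]
  simp only [map_configurationPath_poissonPointLaw, channel, intensity_zero hx, inputRegion]

instance isProbabilityMeasure_channel (α : ℝ≥0) (x : Time T → Band L) :
    IsProbabilityMeasure (channel L α T x) :=
  inferInstanceAs (IsProbabilityMeasure (Measure.infinitePi _))

theorem sum_channel_real_dec_eq_le (hT : 0 ≤ T) {M : ℕ} (c : Code L T M) :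
    ∑ k, (channel L 0 T (c.enc k)).real {y | c.dec y = k}
      ≤ ∑ j ∈ Finset.range M, (1 - Real.exp (-T)) ^ j := by
  let decode (ω : Band L → Configuration (Time T)) : Fin M :=
    c.dec fun i => configurationPath (ω i)
  have hdecode : Measurable decode := c.measurable_dec.comp measurable_configurationPath_comp
  have hchannel (k : Fin M) : (channel L 0 T (c.enc k)).real {y | c.dec y = k}
      = (cond (poissonFieldLaw fun _ => timeVolume T)
          (regionVoid (inputRegion (c.enc k) (c.measurable_enc k)))).real (decode ⁻¹' {k}) := by
    rw [channel_eq_map_cond hT (c.measurable_enc k)]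
    exact map_measureReal_apply measurable_configurationPath_comp
      (c.measurable_dec (measurableSet_singleton k))
  simp only [hchannel]
  simpa only [Fintype.card_fin] using
    (isIndepAvoidance_regionVoid fun _ : Band L => timeVolume T).sum_cond_real_le
      (Real.exp_pos (-T)) (fun k => poissonFieldLaw_real_inputRegion hT (c.measurable_enc k))
      (fun k => hdecode (measurableSet_singleton k))
      fun k l hkl => (Set.disjoint_singleton.2 hkl).preimage decode

end Channel

section FirstVoidCode

variable {T : ℝ} {L : ℕ∞} {M : ℕ}

/-- The average error probability of the decoder that chooses the first band without points, for
`M` messages sent by silencing one band each, where `p` is the probability that an unsilenced band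
has no points: message `j` is decoded correctly if none of the `j` preceding bands is empty. -/
def firstVoidError (p : ℝ) (M : ℕ) : ℝ := (∑ j ∈ Finset.range M, (1 - (1 - p) ^ j)) / M

theorem Code.channel_real_dec_ne (c : Code L T M) (α : ℝ≥0) (k : Fin M) :
    (channel L α T (c.enc k)).real {y | c.dec y ≠ k}
      = 1 - (channel L α T (c.enc k)).real {y | c.dec y = k} :=
  probReal_compl_eq_one_sub (c.measurable_dec (measurableSet_singleton k))

theorem firstVoidError_le_avgError (hT : 0 ≤ T) (c : Code L T M) :
    firstVoidError (Real.exp (-T)) M ≤ c.avgError 0 := by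
  simp only [firstVoidError, Code.avgError, c.channel_real_dec_ne, Finset.sum_sub_distrib,
    Finset.sum_const, Finset.card_range, Finset.card_univ, Fintype.card_fin]
  gcongr
  exact sum_channel_real_dec_eq_le hT c

/-- The end `T` of the time interval, where the value of a path is its total number of points. -/
def endTime (hT : 0 ≤ T) : Time T := ⟨T, Set.right_mem_Icc.2 hT⟩

/-- The band `k + 1`, which is silenced to send the message `k`. -/
def messageBand (hML : (M : ℕ∞) ≤ L) : Fin M ↪ Band L where
  toFun k := ⟨k + 1, Nat.le_add_left 1 k, (Nat.cast_le.2 k.isLt).trans hML⟩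
  inj' _ _ h := Fin.ext (Nat.succ_injective (congrArg Subtype.val h))

/-- The first index at which `v` vanishes, or an arbitrary index if there is none. -/
def firstZero [NeZero M] (v : Fin M → ℕ) : Fin M :=
  Classical.epsilon fun k => IsLeast {j | v j = 0} k

theorem firstZero_eq [NeZero M] {v : Fin M → ℕ} {k : Fin M} (hk : IsLeast {j | v j = 0} k) :
    firstZero v = k :=
  IsLeast.unique (Classical.epsilon_spec (p := fun k => IsLeast {j | v j = 0} k) ⟨k, hk⟩) hk

/-- The code that silences the band of the message and chooses the first band whose process has no
points up to time `T`. -/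
def firstVoidCode [NeZero M] (hT : 0 ≤ T) (hML : (M : ℕ∞) ≤ L) : Code L T M where
  enc k _ := messageBand hML k
  measurable_enc _ := measurable_const
  dec y := firstZero fun k => y (messageBand hML k) (endTime hT)
  measurable_dec := (measurable_of_countable firstZero).comp <| measurable_pi_lambda _ fun k =>
    (measurable_pi_apply _).comp (measurable_pi_apply (messageBand hML k))

theorem poissonProcessLaw_real_eq_zero (hT : 0 ≤ T) (ν : Measure (Time T)) [IsFiniteMeasure ν] :
    (poissonProcessLaw ν).real {y | y (endTime hT) = 0} = Real.exp (-ν.real Set.univ) := by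
  have hpre : configurationPath ⁻¹' {y : Path T | y (endTime hT) = 0} = voidEvent Set.univ := by
    ext c
    have hle (j : Fin c.1) : c.2 j ≤ endTime hT := (c.2 j).2.2
    simp only [Set.mem_preimage, Set.mem_ofPred_eq, configurationPath, countingPath, voidEvent,
      Finset.card_eq_zero, Finset.filter_eq_empty_iff, Finset.mem_univ, true_imp_iff, Set.mem_univ,
      hle]
  have hm : MeasurableSet {y : Path T | y (endTime hT) = 0} :=
    measurable_pi_apply _ (measurableSet_singleton 0)
  rw [← map_configurationPath_poissonPointLaw, map_measureReal_apply measurable_configurationPath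
    hm, hpre, poissonPointLaw_real_voidEvent ν .univ]

theorem poissonProcessLaw_intensity_const_real_eq_zero (hT : 0 ≤ T) (b i : Band L) :
    (poissonProcessLaw (intensity 0 (fun _ : Time T => b) i)).real {y | y (endTime hT) = 0}
      = if b = i then 1 else Real.exp (-T) := by
  rw [poissonProcessLaw_real_eq_zero hT, intensity_zero measurable_const]
  split_ifs with h
  · simp [h]
  · simp [h, timeVolume_real_univ hT]

theorem channel_const_real_eq_zero_and_ne_zero (hT : 0 ≤ T) {b : Band L} {s : Finset (Band L)}
    (hb : b ∉ s) :
    (channel L 0 T fun _ => b).real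
        {y | y b (endTime hT) = 0 ∧ ∀ i ∈ s, y i (endTime hT) ≠ 0}
      = (1 - Real.exp (-T)) ^ s.card := by
  classical
  let Z : Set (Path T) := {y | y (endTime hT) = 0}
  let t (i : Band L) : Set (Path T) := if b = i then Z else Zᶜ
  have hZ : MeasurableSet Z := measurable_pi_apply _ (measurableSet_singleton 0)
  have ht (i : Band L) : MeasurableSet (t i) := by
    simp only [t]
    split_ifs
    exacts [hZ, hZ.compl]
  have hne (i : Band L) (hi : i ∈ s) : b ≠ i := fun h => hb (h ▸ hi)
  have hpi : {y | y b (endTime hT) = 0 ∧ ∀ i ∈ s, y i (endTime hT) ≠ 0}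
      = Set.pi (insert b s : Finset (Band L)) t := by
    ext y
    simp +contextual [Set.mem_pi, t, Z, hne]
  have hprob (i : Band L) : (poissonProcessLaw (intensity 0 (fun _ : Time T => b) i)).real (t i)
      = if b = i then 1 else 1 - Real.exp (-T) := by
    have hzero : (poissonProcessLaw (intensity 0 (fun _ : Time T => b) i)).real Z = _ :=
      poissonProcessLaw_intensity_const_real_eq_zero hT b i
    by_cases h : b = i
    · simp only [t, h, if_true] at hzero ⊢
      exact hzero
    · simp only [t, h, if_false, probReal_compl_eq_one_sub hZ] at hzero ⊢
      rw [hzero]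
  calc _ = ∏ i ∈ insert b s, if b = i then 1 else 1 - Real.exp (-T) := by
        rw [hpi, Measure.real, channel, Measure.infinitePi_pi _ fun i _ => ht i,
          ENNReal.toReal_prod]
        exact Finset.prod_congr rfl fun i _ => hprob i
    _ = (1 - Real.exp (-T)) ^ s.card := by
        rw [Finset.prod_insert hb, if_pos rfl, one_mul,
          Finset.prod_congr rfl fun i hi => if_neg (hne i hi), Finset.prod_const]

theorem one_sub_exp_neg_pow_le_channel_real (hT : 0 ≤ T) (hML : (M : ℕ∞) ≤ L) (k : Fin M) :
    (1 - Real.exp (-T)) ^ (k : ℕ) ≤ (channel L 0 T fun _ => messageBand hML k).real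
      {y | IsLeast {j | y (messageBand hML j) (endTime hT) = 0} k} := by
  have hk : messageBand hML k ∉ (Finset.Iio k).map (messageBand hML) := by simp
  rw [← Fin.card_Iio k, ← Finset.card_map (messageBand hML),
    ← channel_const_real_eq_zero_and_ne_zero hT hk]
  refine measureReal_mono fun y ⟨hy0, hy⟩ => ⟨hy0, fun j hj => not_lt.1 fun hjk => ?_⟩
  exact hy _ (Finset.mem_map_of_mem _ (Finset.mem_Iio.2 hjk)) hj

theorem avgError_firstVoidCode_le [NeZero M] (hT : 0 ≤ T) (hML : (M : ℕ∞) ≤ L) :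
    (firstVoidCode hT hML).avgError 0 ≤ firstVoidError (Real.exp (-T)) M := by
  rw [Code.avgError, firstVoidError,
    ← Fin.sum_univ_eq_sum_range (fun j => 1 - (1 - Real.exp (-T)) ^ j)]
  gcongr with k
  rw [Code.channel_real_dec_ne]
  exact sub_le_sub_left ((one_sub_exp_neg_pow_le_channel_real hT hML k).trans
    (measureReal_mono fun y hy => firstZero_eq hy)) 1

theorem mem_achievable_iff (hT : 0 ≤ T) (hML : (M : ℕ∞) ≤ L) {ε : ℝ} :
    M ∈ achievable L 0 T ε ↔ 1 ≤ M ∧ firstVoidError (Real.exp (-T)) M ≤ ε := by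
  refine and_congr_right fun hM => ⟨fun ⟨c, hc⟩ => (firstVoidError_le_avgError hT c).trans hc,
    fun hε => ?_⟩
  have : NeZero M := ⟨Nat.one_le_iff_ne_zero.1 hM⟩
  exact ⟨firstVoidCode hT hML, (avgError_firstVoidCode_le hT hML).trans hε⟩

end FirstVoidCode

section ErrorEstimates

theorem sum_range_div_le_sum_range_div {a : ℕ → ℝ} (ha : Monotone a) {M N : ℕ} (hM : 1 ≤ M)
    (hMN : M ≤ N) : (∑ j ∈ Finset.range M, a j) / M ≤ (∑ j ∈ Finset.range N, a j) / N := by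
  induction N, hMN using Nat.le_induction with
  | base => rfl
  | succ N hN ih =>
    refine ih.trans ?_
    have hN0 : (0 : ℝ) < N := Nat.cast_pos.2 (hM.trans hN)
    have hlast : ∑ j ∈ Finset.range N, a j ≤ N * a N := by
      simpa using Finset.sum_le_card_nsmul (Finset.range N) a (a N) fun j hj =>
        ha (Finset.mem_range.1 hj).le
    rw [div_le_div_iff₀ hN0 (by positivity), Finset.sum_range_succ]
    push_cast
    linarith

theorem sum_range_mul_div {M : ℕ} (hM : 1 ≤ M) (q : ℝ) :
    (∑ j ∈ Finset.range M, j * q) / M = (M - 1) * q / 2 := by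
  have hM0 : (M : ℝ) ≠ 0 := Nat.cast_ne_zero.2 (Nat.one_le_iff_ne_zero.1 hM)
  have hgauss : (∑ j ∈ Finset.range M, (j : ℝ)) * 2 = M * (M - 1) := by
    have := Finset.sum_range_id_mul_two M
    rw [← Nat.cast_inj (R := ℝ)] at this
    push_cast [Nat.cast_sub hM] at this
    exact this
  rw [← Finset.sum_mul, div_eq_div_iff hM0 two_ne_zero, mul_right_comm, hgauss]
  ring

variable {p : ℝ} {M N : ℕ}

theorem monotone_one_sub_one_sub_pow (hp0 : 0 ≤ p) (hp1 : p ≤ 1) :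
    Monotone fun j : ℕ => 1 - (1 - p) ^ j :=
  fun _ _ hij => sub_le_sub_left
    (pow_le_pow_of_le_one (sub_nonneg.2 hp1) (sub_le_self 1 hp0) hij) 1

theorem firstVoidError_nonneg (hp0 : 0 ≤ p) (hp1 : p ≤ 1) : 0 ≤ firstVoidError p M :=
  div_nonneg (Finset.sum_nonneg fun _ _ =>
    sub_nonneg.2 (pow_le_one₀ (sub_nonneg.2 hp1) (sub_le_self 1 hp0))) M.cast_nonneg

theorem firstVoidError_mono (hp0 : 0 ≤ p) (hp1 : p ≤ 1) (hM : 1 ≤ M) (hMN : M ≤ N) :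
    firstVoidError p M ≤ firstVoidError p N :=
  sum_range_div_le_sum_range_div (monotone_one_sub_one_sub_pow hp0 hp1) hM hMN

theorem firstVoidError_le (hp1 : p ≤ 1) (hM : 1 ≤ M) :
    firstVoidError p M ≤ (M - 1) * p / 2 := by
  rw [firstVoidError, ← sum_range_mul_div hM]
  gcongr with j
  have := one_add_mul_le_pow (show -2 ≤ -p by linarith) j
  rw [← sub_eq_add_neg] at this
  linarith

theorem mul_div_one_add_mul_le (hp0 : 0 ≤ p) (hp1 : p ≤ 1) (j : ℕ) :
    j * p / (1 + j * p) ≤ 1 - (1 - p) ^ j := by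
  have hpos : 0 < 1 + j * p := by positivity
  have hle : (1 - p) ^ j * (1 + j * p) ≤ 1 := calc
    (1 - p) ^ j * (1 + j * p) ≤ (1 - p) ^ j * (1 + p) ^ j := by
      gcongr
      exact one_add_mul_le_pow (by linarith) j
    _ = (1 - p ^ 2) ^ j := by rw [← mul_pow]; ring
    _ ≤ 1 := pow_le_one₀ (by nlinarith) (by nlinarith)
  rw [div_le_iff₀ hpos]
  linarith

theorem le_firstVoidError (hp0 : 0 ≤ p) (hp1 : p ≤ 1) (hM : 1 ≤ M) :
    (M - 1) * (p / (1 + (M - 1) * p)) / 2 ≤ firstVoidError p M := by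
  rw [firstVoidError, ← sum_range_mul_div hM]
  gcongr with j hj
  have hjM : (j : ℝ) ≤ M - 1 := by
    have : (j : ℝ) + 1 ≤ M := by exact_mod_cast Finset.mem_range.1 hj
    linarith
  calc j * (p / (1 + (M - 1) * p)) ≤ j * (p / (1 + j * p)) := by gcongr
    _ = j * p / (1 + j * p) := mul_div_assoc' _ _ _
    _ ≤ 1 - (1 - p) ^ j := mul_div_one_add_mul_le hp0 hp1 j

theorem cast_le_of_firstVoidError_le {ε : ℝ} (hp0 : 0 < p) (hp1 : p ≤ 1) (hM : 1 ≤ M)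
    (hε : ε ≤ 1 / 3) (h : firstVoidError p M ≤ ε) : (M : ℝ) ≤ 7 * max (ε / p) 1 := by
  have hM1 : (1 : ℝ) ≤ M := by exact_mod_cast hM
  have hu : 0 ≤ (M - 1) * p := mul_nonneg (by linarith) hp0.le
  have hlow : (M - 1) * p ≤ 2 * ε * (1 + (M - 1) * p) := by
    have := (le_firstVoidError hp0.le hp1 hM).trans h
    rw [mul_div_assoc', div_le_iff₀ two_pos, div_le_iff₀ (by positivity)] at this
    linarith
  have hup : (M - 1) * p ≤ 6 * ε := by nlinarith
  have hdiv : (M : ℝ) - 1 ≤ 6 * (ε / p) := by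
    rw [mul_div_assoc', le_div_iff₀ hp0]
    exact hup
  linarith [le_max_left (ε / p) 1, le_max_right (ε / p) 1]

end ErrorEstimates

section OptimalCodes

variable {T ε R : ℝ} {L : ℕ∞} {α : ℝ≥0} {M : ℕ}

theorem maxMessages_eq_of_isGreatest (hM : IsGreatest (achievable L α T ε) M) :
    maxMessages L α T ε = M :=
  le_antisymm (iSup₂_le fun _ hN => Nat.cast_le.2 (hM.2 hN)) (le_iSup₂_of_le M hM.1 le_rfl)

theorem cast_le_maxMessages_iff (hM : 1 ≤ M) :
    (M : ℕ∞) ≤ maxMessages L α T ε ↔ ∃ N ∈ achievable L α T ε, M ≤ N := by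
  refine ⟨fun h => ?_, fun ⟨N, hN, hMN⟩ => le_iSup₂_of_le N hN (Nat.cast_le.2 hMN)⟩
  have hlt : ((M - 1 : ℕ) : ℕ∞) < maxMessages L α T ε :=
    (Nat.cast_lt.2 (Nat.sub_lt hM one_pos)).trans_le h
  simp only [maxMessages, lt_iSup_iff] at hlt
  obtain ⟨N, hN, hMN⟩ := hlt
  exact ⟨N, hN, Nat.le_of_pred_lt (Nat.cast_lt.1 hMN)⟩

theorem exp_neg_le_one (hT : 0 ≤ T) : Real.exp (-T) ≤ 1 := Real.exp_le_one_iff.2 (neg_nonpos.2 hT)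

theorem exists_isGreatest_achievable (hT : 0 ≤ T) (hε : 0 < ε) (hε' : ε ≤ 1 / 3) :
    ∃ m, IsGreatest (achievable ⊤ 0 T ε) m ∧
      (m : ℝ) ∈ Set.Icc (max (ε * Real.exp T) 1) (7 * max (ε * Real.exp T) 1) := by
  have hup (M : ℕ) (hM : M ∈ achievable ⊤ 0 T ε) : (M : ℝ) ≤ 7 * max (ε * Real.exp T) 1 := by
    obtain ⟨hM1, hMε⟩ := (mem_achievable_iff hT le_top).1 hM
    simpa only [Real.exp_neg, div_inv_eq_mul] using
      cast_le_of_firstVoidError_le (Real.exp_pos _) (exp_neg_le_one hT) hM1 hε' hMε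
  have hpos : 0 < ε * Real.exp T := by positivity
  let N : ℕ := ⌊1 + 2 * (ε * Real.exp T)⌋₊
  have hN1 : 1 ≤ N := Nat.le_floor (by push_cast; linarith)
  have hNle : (N : ℝ) ≤ 1 + 2 * (ε * Real.exp T) := Nat.floor_le (by linarith)
  have hNlt : 1 + 2 * (ε * Real.exp T) < N + 1 := Nat.lt_floor_add_one _
  have hN : N ∈ achievable ⊤ 0 T ε := by
    refine (mem_achievable_iff hT le_top).2
      ⟨hN1, (firstVoidError_le (exp_neg_le_one hT) hN1).trans ?_⟩
    calc (N - 1) * Real.exp (-T) / 2 ≤ 2 * (ε * Real.exp T) * Real.exp (-T) / 2 := by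
          gcongr
          linarith
      _ = ε := by rw [Real.exp_neg]; field_simp
  have hbdd : BddAbove (achievable ⊤ 0 T ε) :=
    ⟨⌊7 * max (ε * Real.exp T) 1⌋₊, fun M hM => Nat.le_floor (hup M hM)⟩
  obtain ⟨m, hm⟩ := hbdd.exists_isGreatest_of_nonempty ⟨N, hN⟩
  have hNm : (N : ℝ) ≤ m := Nat.cast_le.2 (hm.2 hN)
  have hN1' : (1 : ℝ) ≤ N := Nat.one_le_cast.2 hN1
  exact ⟨m, hm, max_le (by linarith) (by linarith), hup m hm.1⟩

theorem max_sub_log_one_div (hε : 0 < ε) :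
    max (T - Real.log (1 / ε)) 0 = Real.log (max (ε * Real.exp T) 1) := by
  rw [Real.strictMonoOn_log.monotoneOn.map_max (Set.mem_Ioi.2 (by positivity))
    (Set.mem_Ioi.2 one_pos), Real.log_one, Real.log_mul hε.ne' (Real.exp_pos T).ne',
    Real.log_exp, one_div, Real.log_inv, sub_neg_eq_add, add_comm]

theorem log_sub_log_mem_Icc_zero_two {a b : ℝ} (hb : 0 < b) (ha : a ∈ Set.Icc b (7 * b)) :
    Real.log a - Real.log b ∈ Set.Icc 0 2 := by
  have hexp : 7 ≤ Real.exp 2 := by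
    have : Real.exp 2 = Real.exp 1 * Real.exp 1 := by rw [← Real.exp_add]; norm_num
    nlinarith [Real.exp_one_gt_d9]
  rw [← Real.log_div (hb.trans_le ha.1).ne' hb.ne']
  refine ⟨Real.log_nonneg ((one_le_div hb).2 ha.1), ?_⟩
  rw [Real.log_le_iff_le_exp (div_pos (hb.trans_le ha.1) hb)]
  exact ((div_le_iff₀ hb).2 ha.2).trans hexp

theorem optError_eq_firstVoidError (hT : 0 ≤ T) (hM : 1 ≤ M) (hML : (M : ℕ∞) ≤ L) :
    optError L 0 T M = firstVoidError (Real.exp (-T)) M := by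
  have hp0 := (Real.exp_pos (-T)).le
  have hp1 := exp_neg_le_one hT
  suffices h : {ε : ℝ | 0 ≤ ε ∧ (M : ℕ∞) ≤ maxMessages L 0 T ε}
      = Set.Ici (firstVoidError (Real.exp (-T)) M) by
    rw [optError, h, csInf_Ici]
  ext ε
  simp only [Set.mem_ofPred_eq, cast_le_maxMessages_iff hM, Set.mem_Ici]
  constructor
  · rintro ⟨-, N, ⟨-, c, hc⟩, hMN⟩
    exact (firstVoidError_mono hp0 hp1 hM hMN).trans ((firstVoidError_le_avgError hT c).trans hc)
  · exact fun h => ⟨(firstVoidError_nonneg hp0 hp1).trans h, M,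
      (mem_achievable_iff hT hML).2 ⟨hM, h⟩, le_rfl⟩

theorem optError_ceil_exp_mem_Icc (hT : 0 < T) (hR0 : 0 < R) (hR1 : R ≤ 1) :
    optError ⊤ 0 T ⌈Real.exp (T * R)⌉₊
      ∈ Set.Icc (Real.exp (-(T * (1 - R))) / 8) (Real.exp (-(T * (1 - R))) / 2) := by
  have hp0 := Real.exp_pos (-T)
  have hp1 := exp_neg_le_one hT.le
  have hexp : Real.exp (T * R) * Real.exp (-T) = Real.exp (-(T * (1 - R))) := by
    rw [← Real.exp_add]
    ring_nf
  have hle : Real.exp (-(T * (1 - R))) ≤ 1 := exp_neg_le_one (by nlinarith)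
  generalize hM : ⌈Real.exp (T * R)⌉₊ = M
  have hlow : Real.exp (T * R) ≤ M := hM ▸ Nat.le_ceil _
  have hup : (M : ℝ) < Real.exp (T * R) + 1 := hM ▸ Nat.ceil_lt_add_one (Real.exp_pos _).le
  have hM2 : 2 ≤ M := by
    have : (1 : ℝ) < M := (Real.one_lt_exp_iff.2 (mul_pos hT hR0)).trans_le hlow
    exact_mod_cast this
  have hM2' : (2 : ℝ) ≤ M := by exact_mod_cast hM2
  have hM1 : 1 ≤ M := one_le_two.trans hM2
  have hMp : (M - 1) * Real.exp (-T) ≤ Real.exp (-(T * (1 - R))) := by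
    rw [← hexp]
    gcongr
    linarith
  have hMp' : Real.exp (-(T * (1 - R))) ≤ 2 * ((M - 1) * Real.exp (-T)) := by
    rw [← hexp, ← mul_assoc]
    gcongr
    linarith
  rw [optError_eq_firstVoidError hT.le hM1 le_top]
  refine ⟨le_trans ?_ (le_firstVoidError hp0.le hp1 hM1),
    (firstVoidError_le hp1 hM1).trans (by linarith)⟩
  rw [mul_div_assoc', div_div, div_le_div_iff₀ (by norm_num) (by nlinarith)]
  nlinarith

theorem optError_ceil_exp_pos (hT : 0 < T) (hR0 : 0 < R) (hR1 : R ≤ 1) :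
    0 < optError ⊤ 0 T ⌈Real.exp (T * R)⌉₊ :=
  (by positivity : 0 < Real.exp (-(T * (1 - R))) / 8).trans_le
    (optError_ceil_exp_mem_Icc hT hR0 hR1).1

theorem optError_ceil_exp_isTheta (hR0 : 0 < R) (hR1 : R ≤ 1) :
    (fun T => optError ⊤ 0 T ⌈Real.exp (T * R)⌉₊) =Θ[atTop] fun T => Real.exp (-(T * (1 - R))) := by
  constructor
  · refine Asymptotics.IsBigO.of_bound (1 / 2) ?_
    filter_upwards [eventually_gt_atTop 0] with T hT
    rw [Real.norm_of_nonneg (optError_ceil_exp_pos hT hR0 hR1).le, Real.norm_eq_abs, Real.abs_exp]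
    linarith [(optError_ceil_exp_mem_Icc hT hR0 hR1).2]
  · refine Asymptotics.IsBigO.of_bound 8 ?_
    filter_upwards [eventually_gt_atTop 0] with T hT
    rw [Real.norm_of_nonneg (optError_ceil_exp_pos hT hR0 hR1).le, Real.norm_eq_abs, Real.abs_exp]
    linarith [(optError_ceil_exp_mem_Icc hT hR0 hR1).1]

theorem tendsto_inv_mul_log_one_div_of_isTheta {f : ℝ → ℝ} {a : ℝ}
    (hf : f =Θ[atTop] fun T => Real.exp (-(T * a))) :
    Tendsto (fun T => T⁻¹ * Real.log (1 / f T)) atTop (𝓝 a) := by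
  obtain ⟨C, hC, hfC⟩ := hf.1.exists_pos
  obtain ⟨c, hc, hfc⟩ := hf.2.exists_pos
  have hlim (b : ℝ) : Tendsto (fun T : ℝ => a + T⁻¹ * b) atTop (𝓝 a) := by
    simpa using tendsto_const_nhds.add (tendsto_inv_atTop_zero.mul_const b)
  have hlog : ∀ᶠ T in atTop, -Real.log (f T) ∈
      Set.Icc (T * a - Real.log C) (T * a + Real.log c) := by
    filter_upwards [hfC.bound, hfc.bound] with T hup hlow
    rw [Real.norm_eq_abs (Real.exp _), Real.abs_exp] at hup hlow
    have hpos : 0 < ‖f T‖ := pos_of_mul_pos_right ((Real.exp_pos _).trans_le hlow) hc.le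
    have hup' := Real.log_le_log hpos hup
    have hlow' := Real.log_le_log (Real.exp_pos _) hlow
    rw [Real.log_mul hC.ne' (Real.exp_pos _).ne', Real.log_exp, Real.norm_eq_abs, Real.log_abs]
      at hup'
    rw [Real.log_mul hc.ne' hpos.ne', Real.log_exp, Real.norm_eq_abs, Real.log_abs] at hlow'
    exact ⟨by linarith, by linarith⟩
  refine tendsto_of_tendsto_of_tendsto_of_le_of_le' (hlim (-Real.log C)) (hlim (Real.log c)) ?_ ?_
  · filter_upwards [hlog, eventually_gt_atTop 0] with T h hT
    rw [one_div, Real.log_inv, inv_mul_eq_div, inv_mul_eq_div, le_div_iff₀ hT, add_mul,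
      div_mul_cancel₀ _ hT.ne']
    linarith [h.1]
  · filter_upwards [hlog, eventually_gt_atTop 0] with T h hT
    rw [one_div, Real.log_inv, inv_mul_eq_div, inv_mul_eq_div, div_le_iff₀ hT, add_mul,
      div_mul_cancel₀ _ hT.ne']
    linarith [h.2]

end OptimalCodes

end

end OCPC

theorem corollary1_general :
    (∀ T ε : ℝ, 0 ≤ T → 0 < ε → ε ≤ 1 / 3 →
      ∃ m : ℕ, IsGreatest (OCPC.achievable ⊤ 0 T ε) m ∧ OCPC.maxMessages ⊤ 0 T ε = (m : ℕ∞) ∧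
        Real.log (m : ℝ) - max (T - Real.log (1 / ε)) 0 ∈ Set.Icc (0 : ℝ) 2) ∧
    (∀ R : ℝ, 0 < R → R ≤ 1 →
      (∀ T : ℝ, 0 < T → 0 < OCPC.optError ⊤ 0 T ⌈Real.exp (T * R)⌉₊) ∧
      Tendsto (fun T : ℝ => T⁻¹ * Real.log (1 / OCPC.optError ⊤ 0 T ⌈Real.exp (T * R)⌉₊))
        atTop (𝓝 (1 - R))) := by
  refine ⟨fun T ε hT hε hε' => ?_, fun R hR0 hR1 =>
    ⟨fun T hT => OCPC.optError_ceil_exp_pos hT hR0 hR1,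
      OCPC.tendsto_inv_mul_log_one_div_of_isTheta (OCPC.optError_ceil_exp_isTheta hR0 hR1)⟩⟩
  obtain ⟨m, hm, hm_mem⟩ := OCPC.exists_isGreatest_achievable hT hε hε'
  refine ⟨m, hm, OCPC.maxMessages_eq_of_isGreatest hm, ?_⟩
  rw [OCPC.max_sub_log_one_div hε]
  exact OCPC.log_sub_log_mem_Icc_zero_two (lt_max_of_lt_right one_pos) hm_mem

theorem corollary1 :
    (∀ T ε : ℝ, 0 < T → 0 < ε → ε ≤ 1 / 12 →
      ∃ m : ℕ, IsGreatest (OCPC.achievable ⊤ 0 T ε) m ∧ OCPC.maxMessages ⊤ 0 T ε = (m : ℕ∞) ∧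
        Real.log (m : ℝ) - max (T - Real.log (1 / ε)) 0 ∈ Set.Icc (0 : ℝ) 2) ∧
    (∀ R : ℝ, 0 < R → R < 1 →
      (∀ T : ℝ, 0 < T → 0 < OCPC.optError ⊤ 0 T ⌈Real.exp (T * R)⌉₊) ∧
      Filter.liminf
        (fun T : ℝ =>
          ((T⁻¹ * Real.log (1 / OCPC.optError ⊤ 0 T ⌈Real.exp (T * R)⌉₊) : ℝ) : EReal))
        Filter.atTop = ((1 - R : ℝ) : EReal)) :=
  ⟨fun T ε hT hε hε' => corollary1_general.1 T ε hT.le hε (by linarith), fun R hR0 hR1 =>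
    (corollary1_general.2 R hR0 hR1.le).imp_right fun h =>
      ((continuous_coe_real_ereal.tendsto _).comp h).liminf_eq⟩
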